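/- Conventions. A left-invariant ordering on a group $G$ is a strict linear ordering $<$ on $G$ such that $g<g'$ implies $hg<hg'$ for all $g,g',h\in G$; its positive cone is $\{g\in G : 1<g\}$. The group $G$ is left-orderable if it has such an ordering. The set $\mathrm{LO}(G)$ of all left-invariant orderings on $G$, viewed as subsets of $G\times G$, carries the topology induced by the product topology of $\{0,1\}^{G\times G}$ (with $\{0,1\}$ discrete); an ordering is isolated if it is an isolated point of $\mathrm{LO}(G)$. A monoid $M$ is of right-$O$-type (resp. left-$O$-type) if it is left-cancellative (resp. right-cancellative), $1$ is its only invertible element, and for all $g,h\in M$ one has $h\in gM$ or $g\in hM$ (resp. $h\in Mg$ or $g\in Mh$); $M$ is of $O$-type if it is both of right- and of left-$O$-type. An element $\Delta\in M$ is right-quasi-central if there is an endomorphism $\phi$ of $M$ with $g\Delta=\Delta\,\phi(g)$ for all $g\in M$. (1) Let $p,q,r\ge 1$ and let $M$ be the monoid with presentation $(a,b\,;\ a=b(a^pb^r)^q)$. Then $a^{p+1}$ is right-quasi-central in $M$, and $M$ is of right-$O$-type. If $r=1$, then $a^{p+1}$ is central in $M$, and $M$ is of $O$-type. (2) Let $p,q\ge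 1$ and let $G$ be the torus knot group $\langle x,y \mid x^{p+1}=y^{q+1}\rangle$. Then $G$ is left-orderable, and the subsemigroup of $G$ generated by $x$ and $x^{-p}y$ is the positive cone of a left-invariant ordering on $G$ that is isolated in $\mathrm{LO}(G)$. -/

import Mathlib

/-- `g` is a left-divisor of `h` in the monoid `M`. -/
def LeftDivides {M : Type*} [Monoid M] (g h : M) : Prop := ∃ c : M, g * c = h

/-- `g` is a right-divisor of `h` in the monoid `M`. -/
def RightDivides {M : Type*} [Monoid M] (g h : M) : Prop := ∃ c : M, c * g = h

/-- Monoids of right-`O`-type: left-cancellative, with no nontrivial invertible element, and any two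
elements are comparable for left-divisibility. -/
structure IsRightOType (M : Type*) [Monoid M] : Prop where
  left_cancel : ∀ h g g' : M, h * g = h * g' → g = g'
  eq_one_of_isUnit : ∀ g : M, IsUnit g → g = 1
  comparable : ∀ g h : M, LeftDivides g h ∨ LeftDivides h g

/-- Monoids of left-`O`-type: right-cancellative, with no nontrivial invertible element, and any two
elements are comparable for right-divisibility. -/
structure IsLeftOType (M : Type*) [Monoid M] : Prop where
  right_cancel : ∀ h g g' : M, g * h = g' * h → g = g'
  eq_one_of_isUnit : ∀ g : M, IsUnit g → g = 1
  comparable : ∀ g h : M, RightDivides g h ∨ RightDivides h g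

/-- Monoids of `O`-type. -/
def IsOType (M : Type*) [Monoid M] : Prop := IsRightOType M ∧ IsLeftOType M

/-- `Δ` is right-quasi-central in `M` when some endomorphism `φ` of `M` satisfies
`g Δ = Δ φ(g)` for every `g`. -/
def IsRightQuasiCentral {M : Type*} [Monoid M] (Δ : M) : Prop :=
  ∃ φ : M →* M, ∀ g : M, g * Δ = Δ * φ g

/-- The two generators `a`, `b` of the monoids below. -/
inductive MonoidGen : Type
  | a
  | b

/-- The single relation `a = b (a ^ p * b ^ r) ^ q` on the free monoid on `a`, `b`. -/
inductive TriangularRel (p q r : ℕ) : FreeMonoid MonoidGen → FreeMonoid MonoidGen → Prop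
  | rel : TriangularRel p q r (FreeMonoid.of MonoidGen.a)
      (FreeMonoid.of MonoidGen.b *
        (FreeMonoid.of MonoidGen.a ^ p * FreeMonoid.of MonoidGen.b ^ r) ^ q)

/-- The monoid presented by `(a, b ; a = b (a ^ p * b ^ r) ^ q)`. -/
abbrev TriangularMonoid (p q r : ℕ) : Type := PresentedMonoid (TriangularRel p q r)

/-- The element of `TriangularMonoid p q r` represented by the generator `a`. -/
def TriangularMonoid.a (p q r : ℕ) : TriangularMonoid p q r :=
  PresentedMonoid.of (TriangularRel p q r) MonoidGen.a

/-- The two generators `x`, `y` of the torus knot groups. -/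
inductive TorusGen : Type
  | x
  | y

/-- The torus knot group `⟨x, y | x ^ m = y ^ n⟩`. -/
abbrev TorusKnotGroup (m n : ℕ) : Type :=
  PresentedGroup ({FreeGroup.of TorusGen.x ^ m * (FreeGroup.of TorusGen.y ^ n)⁻¹} :
    Set (FreeGroup TorusGen))

/-- The generator `x` of the torus knot group. -/
def TorusKnotGroup.x (m n : ℕ) : TorusKnotGroup m n := PresentedGroup.of TorusGen.x

/-- The generator `y` of the torus knot group. -/
def TorusKnotGroup.y (m n : ℕ) : TorusKnotGroup m n := PresentedGroup.of TorusGen.y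

/-- A left-invariant ordering on the group `G`: a strict linear ordering `<` such that `g < g'`
implies `h g < h g'`. The type `LeftOrdering G` is the set `LO(G)`. -/
@[ext]
structure LeftOrdering (G : Type*) [Group G] where
  lt : G → G → Prop
  isStrictTotalOrder : IsStrictTotalOrder G lt
  mul_left : ∀ h g g' : G, lt g g' → lt (h * g) (h * g')

/-- The positive cone `{g | 1 < g}` of a left-invariant ordering. -/
def LeftOrdering.positiveCone {G : Type*} [Group G] (o : LeftOrdering G) : Set G :=
  {g | o.lt 1 g}

open scoped Classical in
/-- The topology on `LO(G)`: an ordering is viewed as a subset of `G × G`, given by its indicator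
function `G × G → Bool`, and the power set carries the product of the discrete topologies. -/
noncomputable instance LeftOrdering.instTopologicalSpace (G : Type*) [Group G] :
    TopologicalSpace (LeftOrdering G) :=
  TopologicalSpace.induced (fun (o : LeftOrdering G) (z : G × G) => decide (o.lt z.1 z.2))
    (inferInstance : TopologicalSpace (G × G → Bool))

/-- A group is left-orderable if it admits a left-invariant ordering. -/
def IsLeftOrderable (G : Type*) [Group G] : Prop := Nonempty (LeftOrdering G)

/-! The relation has the form `a = b w`, so every nonempty word can be made to begin with `b`, and
deleting that `b` never lengthens a chain of relations, and shortens one that acts on the first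
letter. Induction on chain length gives left cancellation (`RelChain.of_cons`) and comparability of
any two elements having a common right multiple (`RelChain.comparable_of_append`).

Common right multiples come from `Δ = a ^ (p + 1)`: it is right-quasi-central (`b_mul_pow`,
`exists_endomorphism`), both generators left-divide it, and `φ` fixes it, so every element
left-divides a power of `Δ` (`exists_mul_eq_pow`). For `r = 1` the element `Δ` is central, and word
reversal respects the relation, so left-`O`-type follows from right-`O`-type.

A monoid of `O`-type embeds in a group, hence here in the torus knot group, with `b` sent to `x ^
(-p) * y`. Comparability on both sides makes each group element an image or the inverse of one, so
the nontrivial images form a positive cone. This cone is finitely generated, hence its ordering is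
isolated. -/

/-! ### Rewriting words by the relation `a = b w` -/

/-- One application, in either direction, of the relation `a = b w` inside a word. -/
inductive RelStep (w : List MonoidGen) : List MonoidGen → List MonoidGen → Prop
  | expand (t) : RelStep w (.a :: t) (.b :: (w ++ t))
  | contract (t) : RelStep w (.b :: (w ++ t)) (.a :: t)
  | cons (s) {u v} : RelStep w u v → RelStep w (s :: u) (s :: v)

/-- At most `n` applications of the relation `a = b w`. -/
inductive RelChain (w : List MonoidGen) : ℕ → List MonoidGen → List MonoidGen → Prop
  | refl (n u) : RelChain w n u u
  | step {n u v z} : RelStep w u v → RelChain w n v z → RelChain w (n + 1) u z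

namespace RelStep

variable {w u v : List MonoidGen}

theorem symm (h : RelStep w u v) : RelStep w v u := by
  induction h with
  | expand t => exact .contract t
  | contract t => exact .expand t
  | cons s _ ih => exact .cons s ih

theorem append_left (x : List MonoidGen) (h : RelStep w u v) : RelStep w (x ++ u) (x ++ v) := by
  induction x with
  | nil => exact h
  | cons s x ih => exact .cons s ih

theorem append_right (x : List MonoidGen) (h : RelStep w u v) : RelStep w (u ++ x) (v ++ x) := by
  induction h with
  | expand t => simpa using RelStep.expand (w := w) (t ++ x)
  | contract t => simpa using RelStep.contract (w := w) (t ++ x)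
  | cons s _ ih => exact .cons s ih

end RelStep

/-- The word obtained by removing an initial `b`, after rewriting an initial `a` as `b w`. -/
def stripB (w : List MonoidGen) : List MonoidGen → List MonoidGen
  | [] => []
  | .a :: u => w ++ u
  | .b :: u => u

/-- A step at the first letter disappears because `a t` and `b w t` both strip to `w t`; a step
further right survives. -/
theorem RelStep.stripB {w u v : List MonoidGen} (h : RelStep w u v) :
    stripB w u = stripB w v ∨ RelStep w (stripB w u) (stripB w v) := by
  cases h with
  | expand t => exact .inl rfl
  | contract t => exact .inl rfl
  | cons s h =>
    cases s with
    | a => exact .inr (h.append_left w)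
    | b => exact .inr h

namespace RelChain

variable {w u v z : List MonoidGen} {m n : ℕ}

theorem mono (h : RelChain w m u v) (hmn : m ≤ n) : RelChain w n u v := by
  induction h generalizing n with
  | refl => exact .refl _ _
  | step h _ ih =>
    obtain ⟨n, rfl⟩ := Nat.exists_eq_add_of_le' (Nat.one_le_of_lt hmn)
    exact .step h (ih (by omega))

theorem single (h : RelStep w u v) : RelChain w 1 u v := .step h (.refl 0 _)

theorem trans (h : RelChain w m u v) (h' : RelChain w n v z) : RelChain w (m + n) u z := by
  induction h with
  | refl => exact h'.mono (by omega)
  | step h _ ih => exact (RelChain.step h (ih h')).mono (by omega)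

theorem symm (h : RelChain w n u v) : RelChain w n v u := by
  induction h with
  | refl => exact .refl _ _
  | step h _ ih => exact ih.trans (single h.symm)

theorem append_left (x : List MonoidGen) (h : RelChain w n u v) :
    RelChain w n (x ++ u) (x ++ v) := by
  induction h with
  | refl => exact .refl _ _
  | step h _ ih => exact .step (h.append_left x) ih

theorem append_right (x : List MonoidGen) (h : RelChain w n u v) :
    RelChain w n (u ++ x) (v ++ x) := by
  induction h with
  | refl => exact .refl _ _
  | step h _ ih => exact .step (h.append_right x) ih

theorem stripB (h : RelChain w n u v) : RelChain w n (stripB w u) (stripB w v) := by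
  induction h with
  | refl => exact .refl _ _
  | step h _ ih =>
    rcases h.stripB with h | h
    · rw [h]
      exact ih.mono (by omega)
    · exact .step h ih

/-- Either a chain never touches the first letter, or removing `b` makes it shorter. -/
theorem tail_or_stripB (h : RelChain w n u v) :
    (u = [] ∧ v = []) ∨ (∃ s u' v', u = s :: u' ∧ v = s :: v' ∧ RelChain w n u' v') ∨
      ∃ m < n, RelChain w m (_root_.stripB w u) (_root_.stripB w v) := by
  induction h with
  | refl n u =>
    cases u with
    | nil => exact .inl ⟨rfl, rfl⟩
    | cons s u => exact .inr (.inl ⟨s, u, u, rfl, rfl, .refl _ _⟩)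
  | @step n u x v h c ih =>
    rcases ih with ⟨rfl, rfl⟩ | ⟨s, x', v', rfl, rfl, h'⟩ | ⟨m, hm, h'⟩
    · cases h
    · cases h with
      -- The first step acts on the first letter, so stripping saves it.
      | expand t => exact .inr (.inr ⟨n, by omega, c.stripB⟩)
      | contract t => exact .inr (.inr ⟨n, by omega, c.stripB⟩)
      | cons s h => exact .inr (.inl ⟨s, _, _, rfl, rfl, .step h h'⟩)
    · refine .inr (.inr ?_)
      rcases h.stripB with h | h
      · exact ⟨m, by omega, h ▸ h'⟩
      · exact ⟨m + 1, by omega, .step h h'⟩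

/-- This is left cancellation by a letter. -/
theorem of_cons (s : MonoidGen) (h : RelChain w n (s :: u) (s :: v)) : RelChain w n u v := by
  induction n using Nat.strong_induction_on generalizing s u v with
  | _ n ih =>
    rcases h.tail_or_stripB with ⟨h, -⟩ | ⟨_, _, _, h₁, h₂, h⟩ | ⟨m, hm, h⟩
    · cases h
    · cases h₁
      cases h₂
      exact h
    · cases s with
      | b => exact h.mono hm.le
      | a =>
        -- Stripping `a` leaves a prefix `w`, whose letters are cancelled one by one, as `m < n`.
        suffices ∀ x : List MonoidGen, RelChain w m (x ++ u) (x ++ v) → RelChain w m u v from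
          (this w h).mono hm.le
        intro x hx
        induction x with
        | nil => exact hx
        | cons s x ihx => exact ihx (ih m hm s hx)

/-- Two words with a common right multiple are comparable for left divisibility. -/
theorem comparable_of_append {s t : List MonoidGen} (h : RelChain w n (u ++ s) (v ++ t)) :
    (∃ c k, RelChain w k (u ++ c) v) ∨ ∃ c k, RelChain w k (v ++ c) u := by
  induction n using Nat.strong_induction_on generalizing u v s t with
  | _ n ih =>
    -- Equal first letters are cancelled, shortening `u`; distinct ones force a step at the head,
    -- and then stripping may lengthen a word but shortens the chain.
    induction u generalizing v with
    | nil => exact .inl ⟨v, 0, .refl _ _⟩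
    | cons x u ihu =>
      cases v with
      | nil => exact .inr ⟨x :: u, 0, .refl _ _⟩
      | cons y v =>
        have cons_cons : ∀ {x u v}, ((∃ c k, RelChain w k (u ++ c) v) ∨
            ∃ c k, RelChain w k (v ++ c) u) →
            (∃ c k, RelChain w k (x :: u ++ c) (x :: v)) ∨
              ∃ c k, RelChain w k (x :: v ++ c) (x :: u) := by
          rintro x u v (⟨c, k, h⟩ | ⟨c, k, h⟩)
          · exact .inl ⟨c, k, h.append_left [x]⟩
          · exact .inr ⟨c, k, h.append_left [x]⟩
        have hexp : ∀ t, RelChain w 1 (.a :: t) (.b :: (w ++ t)) := fun t ↦ single (.expand t)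
        rcases h.tail_or_stripB with ⟨h, -⟩ | ⟨_, _, _, h₁, h₂, h⟩ | ⟨m, hm, h'⟩
        · cases h
        · cases h₁
          cases h₂
          exact cons_cons (ihu h)
        · cases x <;> cases y
          · exact cons_cons (ihu (of_cons _ h))
          · have h' : RelChain w m ((w ++ u) ++ s) (v ++ t) := by
              simpa [_root_.stripB] using h'
            rcases cons_cons (x := .b) (ih m hm h') with ⟨c, k, h⟩ | ⟨c, k, h⟩
            · exact .inl ⟨c, _, ((hexp u).append_right c).trans h⟩
            · exact .inr ⟨c, _, h.trans (hexp u).symm⟩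
          · have h' : RelChain w m (u ++ s) ((w ++ v) ++ t) := by
              simpa [_root_.stripB] using h'
            rcases cons_cons (x := .b) (ih m hm h') with ⟨c, k, h⟩ | ⟨c, k, h⟩
            · exact .inl ⟨c, _, h.trans (hexp v).symm⟩
            · exact .inr ⟨c, _, ((hexp v).append_right c).trans h⟩
          · exact cons_cons (ihu (of_cons _ h))

end RelChain

/-! ### Cancellation, comparability and units in the presented monoid -/

namespace TriangularMonoid

variable {p q r : ℕ}

/-- The element of `TriangularMonoid p q r` represented by the generator `b`. -/
def b (p q r : ℕ) : TriangularMonoid p q r :=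
  PresentedMonoid.of (TriangularRel p q r) MonoidGen.b

/-- The word `(a ^ p * b ^ r) ^ q`. -/
def complementWord (p q r : ℕ) : List MonoidGen :=
  FreeMonoid.toList ((FreeMonoid.of MonoidGen.a ^ p * FreeMonoid.of MonoidGen.b ^ r) ^ q)

/-- The element represented by a word. -/
def ofWord (p q r : ℕ) (u : List MonoidGen) : TriangularMonoid p q r :=
  PresentedMonoid.mk _ (FreeMonoid.ofList u)

theorem ofWord_append (u v : List MonoidGen) :
    ofWord p q r (u ++ v) = ofWord p q r u * ofWord p q r v := by
  simp [ofWord, FreeMonoid.ofList_append]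

theorem ofWord_cons (s : MonoidGen) (v : List MonoidGen) :
    ofWord p q r (s :: v) = ofWord p q r [s] * ofWord p q r v :=
  ofWord_append [s] v

theorem exists_ofWord (g : TriangularMonoid p q r) : ∃ u, ofWord p q r u = g :=
  PresentedMonoid.surjective_mk g

theorem a_eq : a p q r = b p q r * (a p q r ^ p * b p q r ^ r) ^ q := by
  have h := PresentedMonoid.mk_eq_mk_of_rel (TriangularRel.rel (p := p) (q := q) (r := r))
  simp only [map_mul, map_pow] at h
  exact h

theorem ofWord_complementWord :
    ofWord p q r (complementWord p q r) = (a p q r ^ p * b p q r ^ r) ^ q := by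
  simp only [ofWord, complementWord, FreeMonoid.ofList_toList, map_mul, map_pow]
  rfl

theorem ofWord_eq_of_relStep {u v : List MonoidGen} (h : RelStep (complementWord p q r) u v) :
    ofWord p q r u = ofWord p q r v := by
  have key : ∀ t, ofWord p q r (.a :: t) = ofWord p q r (.b :: (complementWord p q r ++ t)) := by
    intro t
    rw [ofWord_cons, ofWord_cons .b, ofWord_append, ofWord_complementWord, ← mul_assoc]
    exact congrArg (· * _) a_eq
  induction h with
  | expand t => exact key t
  | contract t => exact (key t).symm
  | cons s _ ih => rw [ofWord_cons, ih, ← ofWord_cons]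

theorem ofWord_eq_iff {u v : List MonoidGen} :
    ofWord p q r u = ofWord p q r v ↔ ∃ n, RelChain (complementWord p q r) n u v := by
  constructor
  · intro h
    let c : Con (FreeMonoid MonoidGen) :=
      { r := fun x y ↦ ∃ n, RelChain (complementWord p q r) n x.toList y.toList
        iseqv := ⟨fun x ↦ ⟨0, .refl _ _⟩, fun ⟨n, h⟩ ↦ ⟨n, h.symm⟩,
          fun ⟨_, h⟩ ⟨_, h'⟩ ↦ ⟨_, h.trans h'⟩⟩
        mul' := fun ⟨_, h⟩ ⟨_, h'⟩ ↦ ⟨_, (h.append_right _).trans (h'.append_left _)⟩ }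
    have hc : conGen (TriangularRel p q r) ≤ c := by
      refine Con.conGen_le.2 ?_
      rintro _ _ ⟨⟩
      refine ⟨1, .single ?_⟩
      simpa [complementWord, FreeMonoid.toList_of_mul, FreeMonoid.toList_of]
        using RelStep.expand (w := complementWord p q r) []
    exact hc (PresentedMonoid.mk_eq_mk_iff.1 h)
  · rintro ⟨n, h⟩
    induction h with
    | refl => rfl
    | step h _ ih => rw [ofWord_eq_of_relStep h, ih]

theorem mul_left_cancel' {h g g' : TriangularMonoid p q r} (e : h * g = h * g') : g = g' := by
  obtain ⟨x, rfl⟩ := exists_ofWord h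
  obtain ⟨u, rfl⟩ := exists_ofWord g
  obtain ⟨v, rfl⟩ := exists_ofWord g'
  rw [← ofWord_append, ← ofWord_append, ofWord_eq_iff] at e
  obtain ⟨n, e⟩ := e
  refine ofWord_eq_iff.2 ⟨n, ?_⟩
  induction x with
  | nil => exact e
  | cons s x ih => exact ih (e.of_cons s)

theorem comparable_of_mul_eq {g h c d : TriangularMonoid p q r} (e : g * c = h * d) :
    LeftDivides g h ∨ LeftDivides h g := by
  obtain ⟨u, rfl⟩ := exists_ofWord g
  obtain ⟨v, rfl⟩ := exists_ofWord h
  obtain ⟨s, rfl⟩ := exists_ofWord c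
  obtain ⟨t, rfl⟩ := exists_ofWord d
  rw [← ofWord_append, ← ofWord_append, ofWord_eq_iff] at e
  obtain ⟨n, e⟩ := e
  refine e.comparable_of_append.imp ?_ ?_ <;>
  · rintro ⟨c, k, h⟩
    exact ⟨ofWord p q r c, by rw [← ofWord_append]; exact ofWord_eq_iff.2 ⟨k, h⟩⟩

theorem eq_one_of_isUnit (g : TriangularMonoid p q r) (hg : IsUnit g) : g = 1 := by
  -- In multiplicative `ℕ`, nonempty words go to `0`, which is not a unit.
  let f : TriangularMonoid p q r →* ℕ := PresentedMonoid.lift (fun _ ↦ 0) <| by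
    rintro _ _ ⟨⟩
    simp
  obtain ⟨u, rfl⟩ := exists_ofWord g
  cases u with
  | nil => exact map_one _
  | cons s u =>
    have h := hg.map f
    rw [ofWord_cons, map_mul, show f (ofWord p q r [s]) = 0 from rfl] at h
    simp at h

/-! ### The quasi-central element `a ^ (p + 1)` -/

/-- The image of `b` under the endomorphism attached to `a ^ (p + 1)`. -/
def shiftB (p q r : ℕ) : TriangularMonoid p q r :=
  b p q r ^ r * (a p q r ^ (p - 1) * b p q r ^ r * (a p q r ^ p * b p q r ^ r) ^ (q - 1)) ^ (r - 1)

/-- With `X = a^p b^r`, expanding `a X = b X X^q` gives `a^(p+1) b^r = b a^p b^(r-1) a`. With `C =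
a^(p-1) b^r X^(q-1)`, the relation reads `a = b a C`, so `C^(r-1)` on the right absorbs the extra
`b^(r-1)`. -/
theorem b_mul_pow (hp : 1 ≤ p) (hq : 1 ≤ q) (hr : 1 ≤ r) :
    b p q r * a p q r ^ (p + 1) = a p q r ^ (p + 1) * shiftB p q r := by
  obtain ⟨p, rfl⟩ := Nat.exists_eq_add_of_le' hp
  obtain ⟨q, rfl⟩ := Nat.exists_eq_add_of_le' hq
  obtain ⟨r, rfl⟩ := Nat.exists_eq_add_of_le' hr
  have hA := a_eq (p := p + 1) (q := q + 1) (r := r + 1)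
  simp only [shiftB, Nat.add_sub_cancel]
  set A := a (p + 1) (q + 1) (r + 1)
  set B := b (p + 1) (q + 1) (r + 1)
  set X := A ^ (p + 1) * B ^ (r + 1) with hX
  set C := A ^ p * B ^ (r + 1) * X ^ q with hC
  have h₁ : A ^ (p + 1) * A * B ^ (r + 1) = B * A ^ (p + 1) * (B ^ r * A) := by
    calc A ^ (p + 1) * A * B ^ (r + 1) = A * X := by rw [hX, ← pow_succ, pow_succ', mul_assoc]
      _ = B * X ^ (q + 1) * X := by rw [← hA]
      _ = B * (X * X ^ (q + 1)) := by rw [mul_assoc, ← pow_succ, ← pow_succ']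
      _ = B * A ^ (p + 1) * (B ^ r * (B * X ^ (q + 1))) := by
        rw [hX]; simp only [mul_assoc, pow_succ B r]
      _ = _ := by rw [← hA]
  have h₂ : A = B * A * C := by
    calc A = B * X ^ (q + 1) := hA
      _ = B * (A ^ (p + 1) * B ^ (r + 1) * X ^ q) := by rw [pow_succ', ← hX]
      _ = B * A * C := by rw [hC, pow_succ' A]; simp only [mul_assoc]
  have h₃ : ∀ k, B ^ k * A * C ^ k = A := by
    intro k
    induction k with
    | zero => simp
    | succ k ih =>
      calc B ^ (k + 1) * A * C ^ (k + 1) = B ^ k * (B * A * C) * C ^ k := by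
            rw [pow_succ B, pow_succ' C]; simp only [mul_assoc]
        _ = A := by rw [← h₂, ih]
  calc B * A ^ (p + 1 + 1) = B * A ^ (p + 1) * A := by rw [pow_succ A (p + 1), mul_assoc]
    _ = B * A ^ (p + 1) * (B ^ r * A) * C ^ r := by
      rw [mul_assoc _ (B ^ r * A), h₃]
    _ = _ := by rw [← h₁, ← pow_succ, mul_assoc]

theorem exists_endomorphism (hp : 1 ≤ p) (hq : 1 ≤ q) (hr : 1 ≤ r) :
    ∃ φ : TriangularMonoid p q r →* TriangularMonoid p q r, φ (a p q r) = a p q r ∧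
      ∀ g, g * a p q r ^ (p + 1) = a p q r ^ (p + 1) * φ g := by
  let f : MonoidGen → TriangularMonoid p q r := fun
    | .a => a p q r
    | .b => shiftB p q r
  have key : ∀ u : FreeMonoid MonoidGen, PresentedMonoid.mk (TriangularRel p q r) u *
      a p q r ^ (p + 1) = a p q r ^ (p + 1) * FreeMonoid.lift f u := by
    intro u
    induction u with
    | one => simp
    | of s =>
      rw [FreeMonoid.lift_eval_of]
      cases s with
      | a => exact (pow_succ' (a p q r) (p + 1)).symm.trans (pow_succ _ _)
      | b => exact b_mul_pow hp hq hr
    | mul x y hx hy => rw [map_mul, mul_assoc, hy, ← mul_assoc, hx, map_mul, mul_assoc]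
  refine ⟨PresentedMonoid.lift f fun u v h ↦ ?_, rfl, fun g ↦ ?_⟩
  -- Left cancellation of `Δ` makes `φ` well defined.
  · refine mul_left_cancel' (h := a p q r ^ (p + 1)) ?_
    rw [← key, ← key, PresentedMonoid.mk_eq_mk_of_rel h]
  · obtain ⟨u, rfl⟩ := PresentedMonoid.surjective_mk g
    exact key u

/-- If `u c = Δ^k` and `φ^k(s) t = Δ`, then `s u c t = s Δ^k t = Δ^k φ^k(s) t = Δ^(k+1)`. -/
theorem exists_mul_eq_pow (hp : 1 ≤ p) (hq : 1 ≤ q) (hr : 1 ≤ r) (g : TriangularMonoid p q r) :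
    ∃ c k, g * c = (a p q r ^ (p + 1)) ^ k := by
  obtain ⟨φ, hφa, hφ⟩ := exists_endomorphism hp hq hr
  have hgen : ∀ s k, ∃ t, φ^[k] (ofWord p q r [s]) * t = a p q r ^ (p + 1) := by
    intro s k
    induction k with
    | zero =>
      cases s with
      | a => exact ⟨a p q r ^ p, (pow_succ' _ _).symm⟩
      | b =>
        refine ⟨(a p q r ^ p * b p q r ^ r) ^ q * a p q r ^ p, ?_⟩
        rw [← mul_assoc, pow_succ']
        exact congrArg (· * _) a_eq.symm
    | succ k ih =>
      obtain ⟨t, ht⟩ := ih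
      refine ⟨φ t, ?_⟩
      rw [Function.iterate_succ_apply', ← map_mul, ht, map_pow, hφa]
  have hpow : ∀ k g, g * (a p q r ^ (p + 1)) ^ k = (a p q r ^ (p + 1)) ^ k * φ^[k] g := by
    intro k
    induction k with
    | zero => simp
    | succ k ih =>
      intro g
      rw [pow_succ', ← mul_assoc, hφ, mul_assoc, ih, mul_assoc, Function.iterate_succ_apply]
  obtain ⟨u, rfl⟩ := exists_ofWord g
  induction u with
  | nil => exact ⟨1, 0, rfl⟩
  | cons s u ih =>
    obtain ⟨c, k, h⟩ := ih
    obtain ⟨t, ht⟩ := hgen s k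
    refine ⟨c * t, k + 1, ?_⟩
    rw [ofWord_cons, mul_assoc, ← mul_assoc _ c, h, ← mul_assoc, hpow, mul_assoc, ht,
      ← pow_succ (a p q r ^ (p + 1))]

theorem isRightOType (hp : 1 ≤ p) (hq : 1 ≤ q) (hr : 1 ≤ r) :
    IsRightOType (TriangularMonoid p q r) where
  left_cancel _ _ _ := mul_left_cancel'
  eq_one_of_isUnit := eq_one_of_isUnit
  comparable g h := by
    obtain ⟨c, k, hc⟩ := exists_mul_eq_pow hp hq hr g
    obtain ⟨d, l, hd⟩ := exists_mul_eq_pow hp hq hr h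
    refine comparable_of_mul_eq (c := c * (a p q r ^ (p + 1)) ^ l)
      (d := d * (a p q r ^ (p + 1)) ^ k) ?_
    rw [← mul_assoc, ← mul_assoc, hc, hd, ← pow_add, ← pow_add, add_comm k]

/-! ### The case `r = 1` -/

theorem pow_mem_center (hp : 1 ≤ p) (hq : 1 ≤ q) :
    a p q 1 ^ (p + 1) ∈ Submonoid.center (TriangularMonoid p q 1) := by
  rw [Submonoid.mem_center_iff]
  intro g
  obtain ⟨u, rfl⟩ := exists_ofWord g
  change Commute _ _
  induction u with
  | nil => exact Commute.one_left _
  | cons s u ih =>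
    rw [ofWord_cons]
    refine Commute.mul_left ?_ ih
    cases s with
    | a => exact (Commute.refl (a p q 1)).pow_right _
    | b =>
      have h := b_mul_pow hp hq le_rfl
      simp only [shiftB, Nat.sub_self, pow_zero, mul_one, pow_one (b p q 1)] at h
      exact h

/-- For `r = 1` the relation is a palindrome up to rebracketing. -/
theorem exists_reverse (p q : ℕ) :
    ∃ ρ : TriangularMonoid p q 1 →* (TriangularMonoid p q 1)ᵐᵒᵖ,
      ∀ g, (ρ (ρ g).unop).unop = g := by
  let f : MonoidGen → (TriangularMonoid p q 1)ᵐᵒᵖ := fun s ↦ .op (PresentedMonoid.of _ s)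
  have hf : ∀ u v, TriangularRel p q 1 u v → FreeMonoid.lift f u = FreeMonoid.lift f v := by
    rintro _ _ ⟨⟩
    apply MulOpposite.unop_injective
    simp only [map_mul, map_pow, FreeMonoid.lift_eval_of, f, MulOpposite.unop_mul,
      MulOpposite.unop_pow, MulOpposite.unop_op, pow_one]
    have h := a_eq (p := p) (q := q) (r := 1)
    rw [pow_one] at h
    change a p q 1 = (b p q 1 * a p q 1 ^ p) ^ q * b p q 1
    -- The rebracketing `b (a^p b)^q = (b a^p)^q b`.
    have hs : SemiconjBy (b p q 1) (a p q 1 ^ p * b p q 1) (b p q 1 * a p q 1 ^ p) :=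
      (mul_assoc _ _ _).symm
    exact h.trans (hs.pow_right q)
  let ρ : TriangularMonoid p q 1 →* (TriangularMonoid p q 1)ᵐᵒᵖ := PresentedMonoid.lift f hf
  refine ⟨ρ, fun g ↦ ?_⟩
  obtain ⟨u, rfl⟩ := exists_ofWord g
  induction u with
  | nil => simp [show ofWord p q 1 [] = 1 from rfl]
  | cons s u ih =>
    rw [ofWord_cons, map_mul, MulOpposite.unop_mul, map_mul, MulOpposite.unop_mul, ih]
    rfl

theorem isLeftOType (hp : 1 ≤ p) (hq : 1 ≤ q) : IsLeftOType (TriangularMonoid p q 1) := by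
  obtain ⟨ρ, hρ⟩ := exists_reverse p q
  have mul_unop : ∀ g h, (ρ (g * h)).unop = (ρ h).unop * (ρ g).unop := by simp
  refine ⟨fun h g g' e ↦ ?_, eq_one_of_isUnit, fun g h ↦ ?_⟩
  · have e' : (ρ h).unop * (ρ g).unop = (ρ h).unop * (ρ g').unop := by
      rw [← mul_unop, ← mul_unop, e]
    rw [← hρ g, mul_left_cancel' e', hρ]
  · refine ((isRightOType hp hq le_rfl).comparable (ρ g).unop (ρ h).unop).imp ?_ ?_ <;>
    · rintro ⟨c, hc⟩
      refine ⟨(ρ c).unop, ?_⟩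
      have := congrArg (fun x ↦ (ρ x).unop) hc
      simpa only [mul_unop, hρ] using this

end TriangularMonoid

/-! ### The group of fractions of a monoid of `O`-type -/

theorem IsLeftOType.mul_ne_one {M : Type*} [Monoid M] (hM : IsLeftOType M) {g h : M}
    (hg : g ≠ 1) : g * h ≠ 1 := by
  intro e
  have e' : h * g = 1 := hM.right_cancel h _ _ (by rw [mul_assoc, e, one_mul, mul_one])
  exact hg (hM.eq_one_of_isUnit g ⟨⟨g, h, e, e'⟩, rfl⟩)

/-- In a monoid of left-`O`-type, all elements can serve as denominators. -/
@[reducible]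
noncomputable def IsLeftOType.oreSet {M : Type*} [Monoid M] (hM : IsLeftOType M) :
    OreLocalization.OreSet (⊤ : Submonoid M) :=
  have key : ∀ r s : M, ∃ n d : M, d * r = n * s := fun r s ↦ by
    rcases hM.comparable r s with ⟨c, hc⟩ | ⟨c, hc⟩
    · exact ⟨1, c, by rw [hc, one_mul]⟩
    · exact ⟨c, 1, by rw [hc, one_mul]⟩
  { ore_right_cancel := fun r₁ r₂ s h ↦ ⟨1, by rw [hM.right_cancel _ _ _ h]⟩
    oreNum := fun r s ↦ (key r s).choose
    oreDenom := fun r s ↦ ⟨(key r s).choose_spec.choose, trivial⟩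
    ore_eq := fun r s ↦ (key r s).choose_spec.choose_spec }

/-- Left-`O`-type provides the Ore localization at all of `M`, where every numerator is a unit; left
cancellation makes the numerator map injective. -/
theorem IsOType.exists_injective_hom.{u} {M : Type u} [Monoid M] (hM : IsOType M) :
    ∃ (H : Type u) (_ : Group H) (f : M →* H), Function.Injective f := by
  let := hM.2.oreSet
  let f : M →* (OreLocalization (⊤ : Submonoid M) M)ˣ :=
    { toFun := fun m ↦ OreLocalization.numeratorUnit ⟨m, trivial⟩
      map_one' := Units.ext (map_one OreLocalization.numeratorHom)
      map_mul' := fun m n ↦ Units.ext (map_mul OreLocalization.numeratorHom m n) }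
  refine ⟨_, inferInstance, f, fun m n e ↦ ?_⟩
  have e' : OreLocalization.oreDiv m (1 : (⊤ : Submonoid M)) = OreLocalization.oreDiv n 1 :=
    congrArg Units.val e
  obtain ⟨u, v, h₁, h₂⟩ := OreLocalization.oreDiv_eq_iff.1 e'
  simp only [OneMemClass.coe_one, mul_one] at h₂
  rw [← h₂] at h₁
  exact (hM.1.left_cancel _ _ _ h₁).symm

/-! ### Orderings and positive cones -/

namespace LeftOrdering

variable {G : Type*} [Group G]

/-- The left-invariant ordering with a given positive cone. -/
def ofCone (P : Subsemigroup G) (one_notMem : (1 : G) ∉ P)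
    (total : ∀ g : G, g ∈ P ∨ g = 1 ∨ g⁻¹ ∈ P) : LeftOrdering G where
  lt g h := g⁻¹ * h ∈ P
  isStrictTotalOrder :=
    { trichotomous := fun g h h₁ h₂ ↦ by
        rcases total (g⁻¹ * h) with h' | h' | h'
        · exact absurd h' h₁
        · exact inv_mul_eq_one.1 h'
        · exact absurd (by simpa using h') h₂
      irrefl := fun g ↦ by simpa using one_notMem
      trans := fun g h k h₁ h₂ ↦ by simpa [mul_assoc] using P.mul_mem h₁ h₂ }
  mul_left k g h := by simp [mul_assoc]

theorem positiveCone_ofCone (P : Subsemigroup G) (h₁ : (1 : G) ∉ P)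
    (h₂ : ∀ g : G, g ∈ P ∨ g = 1 ∨ g⁻¹ ∈ P) : (ofCone P h₁ h₂).positiveCone = P := by
  ext g
  simp [positiveCone, ofCone]

theorem lt_iff (o : LeftOrdering G) {g h : G} : o.lt g h ↔ g⁻¹ * h ∈ o.positiveCone := by
  constructor
  · intro hlt
    simpa [positiveCone] using o.mul_left g⁻¹ _ _ hlt
  · intro hlt
    simpa using o.mul_left g _ _ hlt

theorem isOpen_setOf_lt (g h : G) : IsOpen {o : LeftOrdering G | o.lt g h} := by
  classical
  refine isOpen_induced_iff.2 ⟨(fun f : G × G → Bool ↦ f (g, h)) ⁻¹' {true}, ?_, ?_⟩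
  · exact (isOpen_discrete _).preimage (continuous_apply _)
  · ext o
    simp

/-- A strict total order admits no proper extension to another one. -/
theorem eq_of_positiveCone_subset {o o' : LeftOrdering G}
    (h : o.positiveCone ⊆ o'.positiveCone) : o' = o := by
  have := o.isStrictTotalOrder
  have := o'.isStrictTotalOrder
  have hlt : ∀ {g k}, o.lt g k → o'.lt g k := fun hgk ↦ o'.lt_iff.2 (h (o.lt_iff.1 hgk))
  ext g k
  refine ⟨fun hgk ↦ ?_, hlt⟩
  rcases trichotomous_of o.lt g k with h' | rfl | h'
  · exact h'
  · exact absurd hgk (irrefl_of o'.lt g)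
  · exact absurd hgk (asymm_of o'.lt (hlt h'))

/-- An ordering with finitely generated positive cone is isolated. -/
theorem isOpen_singleton {o : LeftOrdering G} {S : Set G} (hS : S.Finite)
    (ho : o.positiveCone = Subsemigroup.closure S) : IsOpen ({o} : Set (LeftOrdering G)) := by
  have : ({o} : Set (LeftOrdering G)) = ⋂ s ∈ S, {o' | o'.lt 1 s} := by
    ext o'
    simp only [Set.mem_singleton_iff, Set.mem_iInter, Set.mem_ofPred_eq]
    constructor
    · rintro rfl s hs
      exact ho.symm.subset (Subsemigroup.subset_closure hs)
    · intro h
      refine eq_of_positiveCone_subset fun g hg ↦ ?_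
      have hg' : g ∈ Subsemigroup.closure S := ho.subset hg
      induction hg' using Subsemigroup.closure_induction with
      | mem s hs => exact h s hs
      | mul x y hx hy ihx ihy =>
        have := o'.isStrictTotalOrder
        have h₁ : o'.lt 1 x := ihx (ho.symm.subset hx)
        have h₂ : o'.lt x (x * y) := by
          simpa using o'.mul_left x _ _ (ihy (ho.symm.subset hy))
        exact trans_of o'.lt h₁ h₂
  rw [this]
  exact hS.isOpen_biInter fun s _ ↦ isOpen_setOf_lt 1 s

end LeftOrdering

/-! ### Torus knot groups -/

namespace TorusKnotGroup

variable (p q : ℕ)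

/-- The element `x ^ (-p) * y`. -/
abbrev b : TorusKnotGroup (p + 1) (q + 1) := (x (p + 1) (q + 1) ^ p)⁻¹ * y (p + 1) (q + 1)

theorem x_pow_eq (m n : ℕ) : x m n ^ m = y m n ^ n := by
  have h := PresentedGroup.one_of_mem (rels := {FreeGroup.of TorusGen.x ^ m *
    (FreeGroup.of TorusGen.y ^ n)⁻¹}) (Set.mem_singleton _)
  simp only [map_mul, map_inv, map_pow] at h
  exact mul_inv_eq_one.1 h

theorem x_eq : x (p + 1) (q + 1) = b p q * (x (p + 1) (q + 1) ^ p * b p q ^ 1) ^ q := by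
  rw [pow_one, mul_inv_cancel_left, mul_assoc, ← pow_succ', ← x_pow_eq,
    pow_succ (x (p + 1) (q + 1)) p, inv_mul_cancel_left]

/-- The homomorphism from the monoid mapping `a` to `x` and `b` to `x ^ (-p) * y`. -/
def ofMonoid : TriangularMonoid p q 1 →* TorusKnotGroup (p + 1) (q + 1) :=
  PresentedMonoid.lift (fun | .a => x (p + 1) (q + 1) | .b => b p q) <| by
    rintro _ _ ⟨⟩
    simpa only [map_mul, map_pow, FreeMonoid.lift_eval_of] using x_eq p q

@[simp]
theorem ofMonoid_a : ofMonoid p q (TriangularMonoid.a p q 1) = x (p + 1) (q + 1) := rfl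

@[simp]
theorem ofMonoid_b : ofMonoid p q (TriangularMonoid.b p q 1) = b p q := rfl

variable {p q}

/-- An embedding of the monoid in a group `H` factors through the torus knot group: in `H`, the
elements `A` and `A^p B` satisfy the torus knot relation. -/
theorem ofMonoid_injective (hM : IsOType (TriangularMonoid p q 1)) :
    Function.Injective (ofMonoid p q) := by
  obtain ⟨H, _, f, hf⟩ := hM.exists_injective_hom
  have hfa := congrArg f (TriangularMonoid.a_eq (p := p) (q := q) (r := 1))
  let A := f (TriangularMonoid.a p q 1)
  let B := f (TriangularMonoid.b p q 1)
  have hA : A = B * (A ^ p * B) ^ q := by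
    simpa only [map_mul, map_pow, pow_one] using hfa
  let φ : TorusKnotGroup (p + 1) (q + 1) →* H :=
    PresentedGroup.toGroup (f := fun | .x => A | .y => A ^ p * B) <| by
      rintro _ rfl
      simp only [map_mul, map_inv, map_pow, FreeGroup.lift_apply_of]
      rw [mul_inv_eq_one, pow_succ' _ q, mul_assoc, ← hA, pow_succ]
  have hx : φ (x (p + 1) (q + 1)) = A := PresentedGroup.toGroup.of _
  have hy : φ (y (p + 1) (q + 1)) = A ^ p * B := PresentedGroup.toGroup.of _
  have hφ : φ.comp (ofMonoid p q) = f := by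
    refine PresentedMonoid.ext _ fun s ↦ ?_
    cases s with
    | a => exact hx
    | b =>
      change φ (b p q) = B
      rw [map_mul, map_inv, map_pow, hx, hy, inv_mul_cancel_left]
  refine Function.Injective.of_comp (f := φ) ?_
  rw [← MonoidHom.coe_comp, hφ]
  exact hf

theorem mem_closure_iff (hM : IsOType (TriangularMonoid p q 1))
    {g : TorusKnotGroup (p + 1) (q + 1)} :
    g ∈ Subsemigroup.closure {x (p + 1) (q + 1), b p q} ↔ ∃ m ≠ 1, ofMonoid p q m = g := by
  -- No step applies to the empty word.
  have gen_ne : ∀ s, TriangularMonoid.ofWord p q 1 [s] ≠ 1 := fun s e ↦ by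
    obtain ⟨n, h⟩ := TriangularMonoid.ofWord_eq_iff.1
      (show TriangularMonoid.ofWord p q 1 [s] = TriangularMonoid.ofWord p q 1 [] from e)
    rcases h.symm with _ | h
    rename_i h _
    cases h
  constructor
  · intro hg
    induction hg using Subsemigroup.closure_induction with
    | mem s hs =>
      rcases hs with rfl | rfl
      · exact ⟨TriangularMonoid.a p q 1, gen_ne .a, ofMonoid_a p q⟩
      · exact ⟨TriangularMonoid.b p q 1, gen_ne .b, ofMonoid_b p q⟩
    | mul _ _ _ _ ih₁ ih₂ =>
      obtain ⟨m, hm, rfl⟩ := ih₁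
      obtain ⟨n, -, rfl⟩ := ih₂
      exact ⟨m * n, hM.2.mul_ne_one hm, map_mul _ _ _⟩
  · rintro ⟨m, hm, rfl⟩
    obtain ⟨u, rfl⟩ := TriangularMonoid.exists_ofWord m
    have hgen : ∀ s, ofMonoid p q (TriangularMonoid.ofWord p q 1 [s]) ∈
        Subsemigroup.closure {x (p + 1) (q + 1), b p q} := fun s ↦ by
      cases s with
      | a => exact Subsemigroup.subset_closure (.inl rfl)
      | b => exact Subsemigroup.subset_closure (.inr rfl)
    cases u with
    | nil => exact absurd rfl hm
    | cons s u =>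
      clear hm
      induction u generalizing s with
      | nil => exact hgen s
      | cons t u ih =>
        rw [TriangularMonoid.ofWord_cons, map_mul]
        exact Subsemigroup.mul_mem _ (hgen s) (ih t)

/-- The images and their inverses form a subgroup: right divisibility reduces `m n⁻¹`, left
divisibility `m⁻¹ n`. It contains `x` and `y`. -/
theorem exists_ofMonoid (hM : IsOType (TriangularMonoid p q 1))
    (g : TorusKnotGroup (p + 1) (q + 1)) : ∃ m, ofMonoid p q m = g ∨ ofMonoid p q m = g⁻¹ := by
  let T : Set (TorusKnotGroup (p + 1) (q + 1)) := {g | ∃ m, ofMonoid p q m = g ∨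
    ofMonoid p q m = g⁻¹}
  have inv_mem : ∀ g ∈ T, g⁻¹ ∈ T := by
    rintro g ⟨m, h⟩
    exact ⟨m, by rwa [inv_inv, or_comm]⟩
  have mul_inv_mem : ∀ m n, ofMonoid p q m * (ofMonoid p q n)⁻¹ ∈ T := by
    intro m n
    rcases hM.2.comparable m n with ⟨c, rfl⟩ | ⟨c, rfl⟩ <;> exact ⟨c, by simp⟩
  have inv_mul_mem : ∀ m n, (ofMonoid p q m)⁻¹ * ofMonoid p q n ∈ T := by
    intro m n
    rcases hM.1.comparable m n with ⟨c, rfl⟩ | ⟨c, rfl⟩ <;> exact ⟨c, by simp⟩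
  have mul_mem : ∀ g ∈ T, ∀ h ∈ T, g * h ∈ T := by
    rintro g ⟨m, hm⟩ h ⟨n, hn⟩
    rcases hm with rfl | hm <;> rcases hn with rfl | hn
    · exact ⟨m * n, .inl (map_mul _ _ _)⟩
    · rw [← inv_inv h, ← hn]
      exact mul_inv_mem m n
    · rw [← inv_inv g, ← hm]
      exact inv_mul_mem m n
    · exact ⟨n * m, .inr (by rw [map_mul, hm, hn, mul_inv_rev])⟩
  let S : Subgroup (TorusKnotGroup (p + 1) (q + 1)) :=
    { carrier := T
      one_mem' := ⟨1, .inl (map_one _)⟩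
      mul_mem' := fun ha hb ↦ mul_mem _ ha _ hb
      inv_mem' := inv_mem _ }
  have hx : x (p + 1) (q + 1) ∈ S := ⟨_, .inl (ofMonoid_a p q)⟩
  have hy : y (p + 1) (q + 1) ∈ S := by
    rw [← mul_inv_cancel_left (x (p + 1) (q + 1) ^ p) (y (p + 1) (q + 1))]
    exact S.mul_mem (S.pow_mem hx p) ⟨_, .inl (ofMonoid_b p q)⟩
  have hS : S = ⊤ := by
    rw [eq_top_iff, ← PresentedGroup.closure_range_of, Subgroup.closure_le]
    rintro _ ⟨s, rfl⟩
    cases s with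
    | x => exact hx
    | y => exact hy
  exact (hS ▸ Subgroup.mem_top g : g ∈ S)

theorem exists_leftOrdering (hp : 1 ≤ p) (hq : 1 ≤ q) :
    ∃ o : LeftOrdering (TorusKnotGroup (p + 1) (q + 1)), o.positiveCone =
      (Subsemigroup.closure {x (p + 1) (q + 1), b p q} : Set (TorusKnotGroup (p + 1) (q + 1))) := by
  have hM : IsOType (TriangularMonoid p q 1) :=
    ⟨TriangularMonoid.isRightOType hp hq le_rfl, TriangularMonoid.isLeftOType hp hq⟩
  refine ⟨.ofCone (Subsemigroup.closure {x (p + 1) (q + 1), b p q}) ?_ ?_,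
    LeftOrdering.positiveCone_ofCone _ _ _⟩
  · rw [mem_closure_iff hM]
    rintro ⟨m, hm, e⟩
    exact hm (ofMonoid_injective hM (e.trans (map_one _).symm))
  · intro g
    simp only [mem_closure_iff hM]
    obtain ⟨m, h⟩ := exists_ofMonoid hM g
    by_cases hm : m = 1
    · subst hm
      right; left
      rcases h with h | h
      · rw [← h, map_one]
      · rw [← inv_eq_one, ← h, map_one]
    · rcases h with h | h
      · exact .inl ⟨m, hm, h⟩
      · exact .inr (.inr ⟨m, hm, h⟩)

end TorusKnotGroup

theorem corollary8p2 :
    -- the monoids `(a, b ; a = b (a ^ p * b ^ r) ^ q)`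
    (∀ p q r : ℕ, 1 ≤ p → 1 ≤ q → 1 ≤ r →
      IsRightQuasiCentral (TriangularMonoid.a p q r ^ (p + 1)) ∧
      IsRightOType (TriangularMonoid p q r) ∧
      (r = 1 →
        TriangularMonoid.a p q r ^ (p + 1) ∈ Submonoid.center (TriangularMonoid p q r) ∧
        IsOType (TriangularMonoid p q r))) ∧
    -- the torus knot groups
    (∀ p q : ℕ, 1 ≤ p → 1 ≤ q →
      IsLeftOrderable (TorusKnotGroup (p + 1) (q + 1)) ∧
      ∃ o : LeftOrdering (TorusKnotGroup (p + 1) (q + 1)),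
        o.positiveCone =
          (Subsemigroup.closure {TorusKnotGroup.x (p + 1) (q + 1),
            (TorusKnotGroup.x (p + 1) (q + 1) ^ p)⁻¹ * TorusKnotGroup.y (p + 1) (q + 1)} :
            Set (TorusKnotGroup (p + 1) (q + 1))) ∧
        IsOpen ({o} : Set (LeftOrdering (TorusKnotGroup (p + 1) (q + 1))))) := by
  refine ⟨fun p q r hp hq hr ↦ ⟨?_, TriangularMonoid.isRightOType hp hq hr, ?_⟩,
    fun p q hp hq ↦ ?_⟩
  · obtain ⟨φ, -, hφ⟩ := TriangularMonoid.exists_endomorphism hp hq hr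
    exact ⟨φ, hφ⟩
  · rintro rfl
    exact ⟨TriangularMonoid.pow_mem_center hp hq, TriangularMonoid.isRightOType hp hq le_rfl,
      TriangularMonoid.isLeftOType hp hq⟩
  · obtain ⟨o, ho⟩ := TorusKnotGroup.exists_leftOrdering hp hq
    exact ⟨⟨o⟩, o, ho, LeftOrdering.isOpen_singleton (Set.toFinite _) ho⟩
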